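/- **Setting.** Let $k,T,n\ge 1$ be integers, let each class $y\in[k]$ have a finite nonempty index set $\mathcal N_y$ of examples $x_i$ ($i\in\mathcal N_y$), let $\ell(\theta,x,y)$ be a loss and $\mathcal S$ a set of perturbations, and put $$L_{y,i}(\theta)=\max_{\delta'\in\mathcal S}\ell(\theta,x_i+\delta',y),\qquad \widehat L_y(\theta)=\frac1{|\mathcal N_y|}\sum_{i\in\mathcal N_y}L_{y,i}(\theta).$$ The algorithm CFOL, with a deterministic model update rule, initial parameters $\theta^1$, step size $\eta$ and mixing parameter $\gamma\in(0,1)$, starts from $w^1=0\in\mathbb R^k$ and does the following in each round $t=1,\dots,T$. It sets $$q^t_y=\frac{e^{w^t_y}}{\sum_{y'=1}^k e^{w^t_{y'}}},\qquad p^t_y=\frac{\gamma}{k}+(1-\gamma)q^t_y ,$$ samples a class $y^t\sim p^t$ and then an index $i^t$ uniformly from $\mathcal N_{y^t}$, computes $\theta^{t+1}$ by the model update rule from $\theta^t$ and the sampled example $(y^t,i^t)$, forms the estimator $\widetilde L^t_y=\mathbf 1_{\{y=y^t\}}L_{y^t,i^t}(\theta^t)/p^t_y$, and sets $w^{t+1}_y=w^t_y+\eta\widetilde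 L^t_y$ for all $y\in[k]$. **Mistake bound.** There is $C'<\infty$ such that, with $C=\max\{k\log k,\,C'\}$, for every sequence of classes $(y^1,\dots,y^T)\in[k]^T$ and indices $i^t\in\mathcal N_{y^t}$, the parameters $\theta^1,\dots,\theta^T$ that the update rule produces along this sequence satisfy $$\sum_{t=1}^T L_{y^t,i^t}(\theta^t)\le C .$$ **Theorem 1.** Suppose that the mistake bound holds and that $L_{y^t,i^t}(\theta^t)\in[0,1]$ for all $t\in[T]$ along all such sequences. Run CFOL with $\eta=\sqrt{\log k/(4kC)}$ (read as $0$ if $k=1$) and $\gamma=\tfrac12$, and, independently of the run, draw $t_1,\dots,t_n$ i.i.d. uniformly from $\{1,\dots,T\}$. Then for every $\delta\in(0,1)$, with probability at least $1-\delta$ over the run and the draw of $t_1,\dots,t_n$, $$\max_{y\in[k]}\frac1n\sum_{j=1}^n\widehat L_y(\theta^{t_j})\le\frac{6C}{T}+\frac{\sqrt{4k\log(2k/\delta)}}{\sqrt T}+\frac{(1+2k)\log(2k/\delta)}{3T}+\frac{\sqrt{2\log(2k/\delta)}}{\sqrt n}+\frac{2\log(2k/\delta)}{3n}.$$ -/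

import Mathlib

open scoped BigOperators ENNReal

noncomputable section

namespace CFOL

/-- Independent sampling: the law of `n` i.i.d. draws from `P`. -/
def iid {α : Type*} (P : PMF α) : (n : ℕ) → PMF (Fin n → α)
  | 0 => PMF.pure Fin.elim0
  | n + 1 => (iid P n).bind fun v => P.map fun a => Fin.snoc v a

section Loss

/-- The adversarial loss `L_{y,i}(θ) = max_{δ ∈ S} ℓ(θ, x_i + δ, y)` on example `i` of class `y`,
as a supremum (which is the maximum whenever that exists). -/
def advLoss {k : ℕ} {Θ E : Type*} [AddCommGroup E] {idx : Fin k → Type*}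
    (l : Θ → E → Fin k → ℝ) (S : Set E) (x : (y : Fin k) → idx y → E)
    (y : Fin k) (i : idx y) (θ : Θ) : ℝ :=
  ⨆ d : S, l θ (x y i + d) y

/-- The empirical class-conditioned risk of class `y`: the average of the losses of the examples
of class `y`, whose index set is `idx y`. -/
def empRisk {k : ℕ} {Θ : Type*} {idx : Fin k → Type*} [∀ y, Fintype (idx y)]
    (L : (y : Fin k) → idx y → Θ → ℝ) (y : Fin k) (θ : Θ) : ℝ :=
  (1 / (Fintype.card (idx y) : ℝ)) * ∑ i, L y i θ

end Loss

section ClassDistribution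

variable {k : ℕ}

/-- The softmax distribution `q` of a weight vector. -/
def softmax (w : Fin k → ℝ) (y : Fin k) : ℝ :=
  Real.exp (w y) / ∑ y', Real.exp (w y')

/-- The mixed class probabilities `p_y = γ / k + (1 - γ) q_y`. -/
def mixed (γ : ℝ) (w : Fin k → ℝ) (y : Fin k) : ℝ :=
  γ * (1 / (k : ℝ)) + (1 - γ) * softmax w y

theorem mixed_nonneg (γ : Set.Ioo (0 : ℝ) 1) (w : Fin k → ℝ) (y : Fin k) :
    0 ≤ mixed γ w y := by
  have h0 := γ.2.1.le
  have h1 : 0 ≤ 1 - (γ : ℝ) := sub_nonneg.2 γ.2.2.le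
  unfold mixed softmax
  positivity

theorem sum_mixed [NeZero k] (γ : ℝ) (w : Fin k → ℝ) : ∑ y, mixed γ w y = 1 := by
  have hk : (k : ℝ) ≠ 0 := Nat.cast_ne_zero.2 (NeZero.ne k)
  have hs : (∑ y' : Fin k, Real.exp (w y')) ≠ 0 :=
    (Finset.sum_pos (fun y _ => Real.exp_pos (w y)) Finset.univ_nonempty).ne'
  have hq : ∑ y : Fin k, softmax w y = 1 := by
    unfold softmax
    rw [← Finset.sum_div, div_self hs]
  unfold mixed
  rw [Finset.sum_add_distrib, ← Finset.mul_sum, ← Finset.mul_sum, hq]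
  simp [hk]

/-- The mixed class probabilities as a probability mass function on the `k` classes. -/
def classPMF [NeZero k] (γ : Set.Ioo (0 : ℝ) 1) (w : Fin k → ℝ) : PMF (Fin k) :=
  PMF.ofFintype (fun y => ENNReal.ofReal (mixed γ w y)) (by
    rw [← ENNReal.ofReal_sum_of_nonneg (fun y _ => mixed_nonneg γ w y), sum_mixed,
      ENNReal.ofReal_one])

end ClassDistribution

section Algorithm

variable {k : ℕ} {Θ : Type*} {idx : Fin k → Type*}

/-- The model parameters after the samples `(y, i)` listed in `h`, starting at `θ₀`. A model update
maps the current parameters and the sampled example to the next parameters; `Θ` may contain any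
internal state of the optimizer. -/
def theta (update : Θ → (Σ y, idx y) → Θ) (θ₀ : Θ) : (t : ℕ) → (Fin t → Σ y, idx y) → Θ
  | 0, _ => θ₀
  | t + 1, h => update (theta update θ₀ t (Fin.init h)) (h (Fin.last t))

/-- In a run with samples `s`, the model parameters at the start of round `t`. -/
def iterate (update : Θ → (Σ y, idx y) → Θ) (θ₀ : Θ) {T : ℕ} (s : Fin T → Σ y, idx y)
    (t : Fin T) : Θ :=
  theta update θ₀ t (Fin.take t t.isLt.le s)

/-- The loss incurred in round `t` of a run with samples `s`. -/
def roundLoss (L : (y : Fin k) → idx y → Θ → ℝ) (update : Θ → (Σ y, idx y) → Θ) (θ₀ : Θ) {T : ℕ}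
    (s : Fin T → Σ y, idx y) (t : Fin T) : ℝ :=
  L (s t).1 (s t).2 (iterate update θ₀ s t)

/-- The mistake bound: along every sequence of classes and class-conditioned sample indices, the
model suffers total loss at most `C = max {k log k, C'}` over `T` rounds. -/
def MistakeBound (L : (y : Fin k) → idx y → Θ → ℝ) (update : Θ → (Σ y, idx y) → Θ) (θ₀ : Θ)
    (T : ℕ) (C : ℝ) : Prop :=
  ∃ C' : ℝ, C = max (k * Real.log k) C' ∧
    ∀ s : Fin T → Σ y, idx y, ∑ t, roundLoss L update θ₀ s t ≤ C

/-- The importance-weighted estimator of the vector of class-conditioned losses, from one sample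
`z = (y, i)` whose class was drawn with probabilities `p`. -/
def estimator (L : (y : Fin k) → idx y → Θ → ℝ) (p : Fin k → ℝ) (θ : Θ) (z : Σ y, idx y)
    (y : Fin k) : ℝ :=
  if y = z.1 then L z.1 z.2 θ / p y else 0

/-- The weights of the adversary after the samples listed in `h`. The adversary maximizes, so that
a large loss of a class increases its weight. -/
def weight (L : (y : Fin k) → idx y → Θ → ℝ) (update : Θ → (Σ y, idx y) → Θ) (θ₀ : Θ)
    (η γ : ℝ) : (t : ℕ) → (Fin t → Σ y, idx y) → Fin k → ℝ
  | 0, _ => fun _ => 0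
  | t + 1, h => fun y =>
      weight L update θ₀ η γ t (Fin.init h) y +
        η * estimator L (mixed γ (weight L update θ₀ η γ t (Fin.init h)))
          (theta update θ₀ t (Fin.init h)) (h (Fin.last t)) y

variable [NeZero k] [∀ y, Fintype (idx y)] [∀ y, Nonempty (idx y)]

/-- One sample of the algorithm: a class from the mixed distribution of the weights `w`, then an
example uniformly from that class. -/
def samplePMF (γ : Set.Ioo (0 : ℝ) 1) (w : Fin k → ℝ) : PMF (Σ y, idx y) :=
  (classPMF γ w).bind fun y => (PMF.uniformOfFintype (idx y)).map fun i => ⟨y, i⟩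

/-- The law of the samples of the first `T` rounds of the algorithm. -/
def run (L : (y : Fin k) → idx y → Θ → ℝ) (update : Θ → (Σ y, idx y) → Θ) (θ₀ : Θ)
    (η : ℝ) (γ : Set.Ioo (0 : ℝ) 1) : (T : ℕ) → PMF (Fin T → Σ y, idx y)
  | 0 => PMF.pure Fin.elim0
  | T + 1 => (run L update θ₀ η γ T).bind fun h =>
      (samplePMF γ (weight L update θ₀ η γ T h)).map fun z => Fin.snoc h z

/-- The joint law of the samples of `T` rounds and of `n` round indices drawn i.i.d. uniformly from
the `T` rounds, independently of the run. -/
def runEnsemble (L : (y : Fin k) → idx y → Θ → ℝ) (update : Θ → (Σ y, idx y) → Θ) (θ₀ : Θ)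
    (η : ℝ) (γ : Set.Ioo (0 : ℝ) 1) (T n : ℕ) [NeZero T] :
    PMF ((Fin T → Σ y, idx y) × (Fin n → Fin T)) :=
  (run L update θ₀ η γ T).bind fun s =>
    (iid (PMF.uniformOfFintype (Fin T)) n).map fun τ => (s, τ)

/-- The worst class-conditioned empirical risk of an ensemble `ϑ` of `n` models (a maximum over the
finitely many classes). -/
def worstRisk {n : ℕ} (L : (y : Fin k) → idx y → Θ → ℝ) (ϑ : Fin n → Θ) : ℝ :=
  ⨆ y : Fin k, (1 / (n : ℝ)) * ∑ j, empRisk L y (ϑ j)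

end Algorithm

end CFOL

end

/-! The class sampler is exponential weights with importance-weighted losses, and the bound splits
into a pathwise part and a random part. Pathwise, the log-sum-exp of the weights grows in each round
by at most a multiple of the loss actually suffered. The mistake bound thus caps the total estimated
loss of every class by `6 * C` (`sum_pathEstimator_le`). The random part replaces estimates by
risks, then the average over rounds by the sampled ensemble. Only one-sided tails are needed: risks
must not exceed estimates, nor sampled risks their mean. A nonnegative variable has a sub-Gaussian
lower tail governed by its second moment alone (`expect_exp_sub_le`). It is applied to the
estimators, whose conditional second moment is at most `2 * k`, and to `1 - f` for a risk `f` in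
`[0, 1]`. A union bound over `2 * k` events of probability at most `δ / (2 * k)` concludes. No
Bernstein correction arises, so the terms of order `1 / T` and `1 / n` with a logarithm are slack.
-/

namespace CFOL

/-! ### Finite expectations, tail bounds and the union bound. -/

section Expectation

variable {α β : Type*} [Fintype α] [Fintype β]

/-- The expectation of a real function under a probability mass function on a finite type. -/
noncomputable def expect (P : PMF α) (f : α → ℝ) : ℝ := ∑ a, (P a).toReal * f a

theorem expect_const (P : PMF α) (c : ℝ) : expect P (fun _ => c) = c := by
  unfold expect
  rw [← Finset.sum_mul, ← ENNReal.toReal_sum fun a _ => P.apply_ne_top a,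
    ← tsum_fintype (L := SummationFilter.unconditional _), P.tsum_coe]
  simp

theorem expect_mono (P : PMF α) {f g : α → ℝ} (h : ∀ a, f a ≤ g a) : expect P f ≤ expect P g :=
  Finset.sum_le_sum fun a _ => mul_le_mul_of_nonneg_left (h a) ENNReal.toReal_nonneg

theorem expect_add (P : PMF α) (f g : α → ℝ) :
    expect P (fun a => f a + g a) = expect P f + expect P g := by
  simp only [expect, mul_add, Finset.sum_add_distrib]

theorem expect_const_mul (P : PMF α) (c : ℝ) (f : α → ℝ) :
    expect P (fun a => c * f a) = c * expect P f := by
  simp only [expect, Finset.mul_sum]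
  exact Finset.sum_congr rfl fun a _ => by ring

theorem expect_sum {ι : Type*} (P : PMF α) (s : Finset ι) (f : ι → α → ℝ) :
    expect P (fun a => ∑ i ∈ s, f i a) = ∑ i ∈ s, expect P (f i) := by
  simp only [expect, Finset.mul_sum]
  exact Finset.sum_comm

theorem expect_bind (P : PMF α) (Q : α → PMF β) (f : β → ℝ) :
    expect (P.bind Q) f = expect P fun a => expect (Q a) f := by
  have h (b : β) : (P.bind Q b).toReal = ∑ a, (P a).toReal * (Q a b).toReal := by
    rw [PMF.bind_apply, tsum_fintype, ENNReal.toReal_sum fun a _ =>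
      ENNReal.mul_ne_top (P.apply_ne_top a) ((Q a).apply_ne_top b)]
    simp only [ENNReal.toReal_mul]
  simp only [expect, h, Finset.sum_mul, Finset.mul_sum]
  rw [Finset.sum_comm]
  exact Finset.sum_congr rfl fun a _ => Finset.sum_congr rfl fun b _ => by ring

theorem expect_pure (a : α) (f : α → ℝ) : expect (PMF.pure a) f = f a := by
  classical
  unfold expect
  rw [Finset.sum_eq_single a]
  · simp
  · intro b _ hb
    simp [PMF.pure_apply, hb]
  · simp

theorem expect_map (P : PMF α) (g : α → β) (f : β → ℝ) :
    expect (P.map g) f = expect P fun a => f (g a) := by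
  rw [PMF.map, expect_bind]
  simp only [Function.comp_apply, expect_pure]

theorem expect_uniform [Nonempty α] (f : α → ℝ) :
    expect (PMF.uniformOfFintype α) f = 1 / (Fintype.card α : ℝ) * ∑ a, f a := by
  simp [expect, Finset.mul_sum]

theorem toOuterMeasure_eq_expect (P : PMF α) (s : Set α) :
    P.toOuterMeasure s = ENNReal.ofReal (expect P (s.indicator fun _ => 1)) := by
  rw [PMF.toOuterMeasure_apply, tsum_fintype, expect, ENNReal.ofReal_sum_of_nonneg]
  · refine Finset.sum_congr rfl fun a _ => ?_
    by_cases h : a ∈ s <;> simp [h, ENNReal.ofReal_toReal (P.apply_ne_top a)]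
  · intro a _
    exact mul_nonneg ENNReal.toReal_nonneg (Set.indicator_nonneg (fun _ _ => zero_le_one) a)

theorem exp_neg_le_quadratic {x : ℝ} (hx : 0 ≤ x) : Real.exp (-x) ≤ 1 - x + x ^ 2 / 2 := by
  have h := Real.quadratic_le_exp_of_nonneg hx
  have hpos : 0 < 1 + x + x ^ 2 / 2 := by positivity
  rw [Real.exp_neg]
  calc (Real.exp x)⁻¹ ≤ (1 + x + x ^ 2 / 2)⁻¹ := inv_anti₀ hpos h
    _ ≤ 1 - x + x ^ 2 / 2 := by
      rw [inv_le_iff_one_le_mul₀ hpos]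
      -- The product `(1 + x + x ^ 2 / 2) * (1 - x + x ^ 2 / 2)` equals `1 + x ^ 4 / 4`.
      nlinarith [sq_nonneg (x ^ 2)]

/-- The lower tail of a nonnegative variable is sub-Gaussian, with the second moment as variance
proxy. -/
theorem expect_exp_sub_le (P : PMF α) {X : α → ℝ} (hX : ∀ a, 0 ≤ X a) {m V : ℝ}
    (hm : expect P X = m) (hV : expect P (fun a => X a ^ 2) ≤ V) {r : ℝ} (hr : 0 ≤ r) :
    expect P (fun a => Real.exp (r * (m - X a))) ≤ Real.exp (V * r ^ 2 / 2) := by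
  have h1 : expect P (fun a => Real.exp (r * (m - X a))) ≤
      expect P fun a => Real.exp (r * m) * (1 + (-r * X a + r ^ 2 / 2 * X a ^ 2)) := by
    refine expect_mono P fun a => ?_
    rw [show r * (m - X a) = r * m + -(r * X a) by ring, Real.exp_add]
    refine mul_le_mul_of_nonneg_left ?_ (Real.exp_pos _).le
    linarith [exp_neg_le_quadratic (mul_nonneg hr (hX a))]
  refine h1.trans ?_
  rw [expect_const_mul, expect_add, expect_const, expect_add, expect_const_mul, expect_const_mul, hm]
  have h2 : 1 + (-r * m + r ^ 2 / 2 * expect P fun a => X a ^ 2) ≤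
      Real.exp (-r * m + V * r ^ 2 / 2) := by
    have h3 := mul_le_mul_of_nonneg_left hV (by positivity : (0 : ℝ) ≤ r ^ 2 / 2)
    linarith [Real.add_one_le_exp (-r * m + V * r ^ 2 / 2)]
  refine (mul_le_mul_of_nonneg_left h2 (Real.exp_pos _).le).trans_eq ?_
  rw [← Real.exp_add]
  congr 1
  ring

/-- Chernoff's bound at the optimal `r = u / v`, where `u = √(2 * v * ε)`: the threshold contributes
`-2 * ε` to the exponent and the moment bound `ε`. -/
theorem expect_indicator_le_of_subgaussian (P : PMF α) (D : α → ℝ) {v ε : ℝ} (hv : 0 < v)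
    (hε : 0 ≤ ε) (hD : ∀ r, 0 ≤ r → expect P (fun a => Real.exp (r * D a)) ≤
      Real.exp (v * r ^ 2 / 2)) :
    expect P ({a | √(2 * v * ε) < D a}.indicator fun _ => 1) ≤ Real.exp (-ε) := by
  have hsq : √(2 * v * ε) ^ 2 = 2 * v * ε := Real.sq_sqrt (by positivity)
  set u := √(2 * v * ε) with hu
  have hu0 : 0 ≤ u := Real.sqrt_nonneg _
  have h1 : expect P ({a | u < D a}.indicator fun _ => 1) ≤
      expect P fun a => Real.exp (-(2 * ε)) * Real.exp (u / v * D a) := by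
    refine expect_mono P fun a => ?_
    by_cases h : u < D a
    · rw [Set.indicator_of_mem (by exact h), ← Real.exp_add, Real.one_le_exp_iff]
      have h2 : u / v * u ≤ u / v * D a := mul_le_mul_of_nonneg_left h.le (by positivity)
      have h3 : u / v * u = 2 * ε := by
        field_simp
        linarith
      linarith
    · rw [Set.indicator_of_notMem (by exact h)]
      positivity
  refine h1.trans ?_
  rw [expect_const_mul]
  refine (mul_le_mul_of_nonneg_left (hD (u / v) (by positivity)) (Real.exp_pos _).le).trans_eq ?_
  rw [← Real.exp_add]
  congr 1
  rw [div_pow, hsq]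
  field_simp
  ring

/-- The union bound for finitely many events, each of probability at most `e`. -/
theorem le_expect_indicator {ι : Type*} [Fintype ι] (P : PMF α) (s : Set α)
    (bad : ι → Set α) {e : ℝ} (hbad : ∀ i, expect P ((bad i).indicator fun _ => 1) ≤ e)
    (hs : ∀ a, (∀ i, a ∉ bad i) → a ∈ s) :
    1 - Fintype.card ι * e ≤ expect P (s.indicator fun _ => 1) := by
  have h1 : expect P (fun _ => 1) ≤ expect P fun a =>
      s.indicator (fun _ => (1 : ℝ)) a + ∑ i, (bad i).indicator (fun _ => 1) a := by
    refine expect_mono P fun a => ?_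
    have h0 (i : ι) : 0 ≤ (bad i).indicator (fun _ => (1 : ℝ)) a :=
      Set.indicator_nonneg (fun _ _ => zero_le_one) a
    by_cases h : ∃ i, a ∈ bad i
    · obtain ⟨i, hi⟩ := h
      have h2 := Finset.single_le_sum (fun i _ => h0 i) (Finset.mem_univ i)
      rw [Set.indicator_of_mem hi] at h2
      have h3 : 0 ≤ s.indicator (fun _ => (1 : ℝ)) a :=
        Set.indicator_nonneg (fun _ _ => zero_le_one) a
      linarith
    · rw [Set.indicator_of_mem (hs a fun i hi => h ⟨i, hi⟩)]
      linarith [Finset.sum_nonneg fun i (_ : i ∈ Finset.univ) => h0 i]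
  rw [expect_const, expect_add, expect_sum] at h1
  have h2 := Finset.sum_le_sum fun i (_ : i ∈ Finset.univ) => hbad i
  rw [Finset.sum_const, Finset.card_univ, nsmul_eq_mul] at h2
  linarith

theorem expect_iid_exp_sum (P : PMF α) (g : α → ℝ) (n : ℕ) :
    expect (iid P n) (fun v => Real.exp (∑ j, g (v j))) = expect P (fun a => Real.exp (g a)) ^ n := by
  induction n with
  | zero => simp [iid, expect_pure]
  | succ n ih =>
    simp only [iid, expect_bind, expect_map, Fin.sum_univ_castSucc, Fin.snoc_castSucc,
      Fin.snoc_last, Real.exp_add, expect_const_mul]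
    simp only [mul_comm (Real.exp _), expect_const_mul, ih, pow_succ']

end Expectation

/-! ### Consequences of mixing with the uniform distribution at `γ = 1 / 2`. -/

section Mixed

variable {k : ℕ}

theorem softmax_le_mixed {γ : ℝ} (hγ : γ = 1 / 2) (w : Fin k → ℝ) (y : Fin k) :
    softmax w y ≤ 2 * mixed γ w y := by
  have : (0 : ℝ) ≤ 1 / k := by positivity
  subst hγ
  unfold mixed
  linarith

theorem inv_le_mixed {γ : ℝ} (hγ : γ = 1 / 2) (w : Fin k → ℝ) (y : Fin k) :
    1 / (2 * k : ℝ) ≤ mixed γ w y := by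
  have h : 0 ≤ softmax w y := by
    unfold softmax
    positivity
  have h1 : 1 / (2 * k : ℝ) = 1 / 2 * (1 / k) := by ring
  subst hγ
  unfold mixed
  linarith

end Mixed

/-! ### Histories, estimators and ranges of the losses. -/

section Runs

variable {k : ℕ} {Θ : Type*} {idx : Fin k → Type*} (L : (y : Fin k) → idx y → Θ → ℝ)
  (update : Θ → (Σ y, idx y) → Θ) (θ₀ : Θ) (η : ℝ)

/-- The sum over the rounds of a function of the past samples and the current one. -/
theorem sum_rounds_succ {Z : Type*} (G : (t : ℕ) → (Fin t → Z) → Z → ℝ) (T : ℕ)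
    (s : Fin (T + 1) → Z) :
    ∑ u : Fin (T + 1), G u (Fin.take u u.isLt.le s) (s u) =
      (∑ u : Fin T, G u (Fin.take u u.isLt.le (Fin.init s)) (Fin.init s u)) +
        G T (Fin.init s) (s (Fin.last T)) := by
  rw [Fin.sum_univ_castSucc]
  rfl

/-- The estimator of the loss of class `y` as a function of the past samples and the current one. -/
noncomputable def pathEstimator (γ : ℝ) (y : Fin k) (t : ℕ) (h : Fin t → Σ y, idx y)
    (z : Σ y, idx y) : ℝ :=
  estimator L (mixed γ (weight L update θ₀ η γ t h)) (theta update θ₀ t h) z y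

theorem weight_eq_sum (γ : ℝ) (y : Fin k) (T : ℕ) (s : Fin T → Σ y, idx y) :
    weight L update θ₀ η γ T s y =
      η * ∑ u : Fin T, pathEstimator L update θ₀ η γ y u (Fin.take u u.isLt.le s) (s u) := by
  induction T with
  | zero => simp [weight]
  | succ T ih =>
    rw [sum_rounds_succ (pathEstimator L update θ₀ η γ y), mul_add, ← ih]
    rfl

/-- In every round `t < T` that is reached, all losses of all examples lie in `[0, 1]`. -/
theorem loss_mem_Icc {T : ℕ}
    (hbdd : ∀ (s : Fin T → Σ y, idx y) (t : Fin T),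
      roundLoss L update θ₀ s t ∈ Set.Icc (0 : ℝ) 1)
    {t : ℕ} (ht : t < T) (h : Fin t → Σ y, idx y) (z : Σ y, idx y) :
    L z.1 z.2 (theta update θ₀ t h) ∈ Set.Icc (0 : ℝ) 1 := by
  obtain ⟨s, hs, hz⟩ : ∃ s : Fin T → Σ y, idx y, Fin.take t ht.le s = h ∧ s ⟨t, ht⟩ = z := by
    -- The hypothesis covers all sequences, so any history followed by any sample may be padded to
    -- length `T`, here with copies of `z`.
    refine ⟨fun u => if hu : u.1 < t then h ⟨u, hu⟩ else z, ?_, by simp⟩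
    ext1 u
    simp [Fin.take]
  have h1 := hbdd s ⟨t, ht⟩
  unfold roundLoss iterate at h1
  simp only [hs] at h1
  rwa [hz] at h1

theorem empRisk_mem_Icc [∀ y, Fintype (idx y)] [∀ y, Nonempty (idx y)] {θ : Θ}
    (h : ∀ z : Σ y, idx y, L z.1 z.2 θ ∈ Set.Icc (0 : ℝ) 1) (y : Fin k) :
    empRisk L y θ ∈ Set.Icc (0 : ℝ) 1 := by
  have hN : (0 : ℝ) < Fintype.card (idx y) := Nat.cast_pos.2 Fintype.card_pos
  unfold empRisk
  constructor
  · exact mul_nonneg (by positivity) (Finset.sum_nonneg fun i _ => (h ⟨y, i⟩).1)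
  · rw [one_div, inv_mul_le_one₀ hN]
    refine (Finset.sum_le_sum fun i _ => (h ⟨y, i⟩).2).trans_eq ?_
    simp

theorem estimator_nonneg {γ : Set.Ioo (0 : ℝ) 1} {w : Fin k → ℝ} {θ : Θ} {z : Σ y, idx y}
    (hz : 0 ≤ L z.1 z.2 θ) (y : Fin k) : 0 ≤ estimator L (mixed γ w) θ z y := by
  unfold estimator
  split_ifs
  · exact div_nonneg hz (mixed_nonneg γ w y)
  · exact le_rfl

/-! ### Pathwise regret of exponential weights. -/

section Regret

variable [NeZero k]

/-- One step of the potential argument for exponential weights. -/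
theorem log_sum_exp_step {γ : ℝ} (hγ : γ = 1 / 2) (hη : 0 ≤ η) (hη' : η * (2 * k) ≤ 1)
    (w : Fin k → ℝ) {θ : Θ} (z : Σ y, idx y) (hz : L z.1 z.2 θ ∈ Set.Icc (0 : ℝ) 1) :
    Real.log (∑ y, Real.exp (w y + η * estimator L (mixed γ w) θ z y)) ≤
      Real.log (∑ y, Real.exp (w y)) + (2 * η + 4 * k * η ^ 2) * L z.1 z.2 θ := by
  obtain ⟨c, i⟩ := z
  simp only at hz
  set M := L c i θ with hM
  have hk : (0 : ℝ) < k := Nat.cast_pos.2 (NeZero.pos k)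
  have hp := inv_le_mixed hγ w c
  have hp0 : 0 < mixed γ w c := lt_of_lt_of_le (by positivity) hp
  have hS : 0 < ∑ y, Real.exp (w y) :=
    Finset.sum_pos (fun y _ => Real.exp_pos (w y)) Finset.univ_nonempty
  set W := ∑ y, Real.exp (w y) with hW
  have hq := softmax_le_mixed hγ w c
  -- Only the weight of the sampled class `c` moves.
  have hsplit : ∑ y, Real.exp (w y + η * estimator L (mixed γ w) θ ⟨c, i⟩ y) =
      W + Real.exp (w c) * (Real.exp (η * (M / mixed γ w c)) - 1) := by
    have : ∀ y, Real.exp (w y + η * estimator L (mixed γ w) θ ⟨c, i⟩ y) = Real.exp (w y) +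
        if y = c then Real.exp (w c) * (Real.exp (η * (M / mixed γ w c)) - 1) else 0 := by
      intro y
      unfold estimator
      by_cases h : y = c
      · subst h
        simp only [if_true, Real.exp_add]
        ring
      · simp [h]
    simp only [this, Finset.sum_add_distrib, Finset.sum_ite_eq', Finset.mem_univ, if_true, ← hW]
  set v := M / mixed γ w c with hv
  have hv0 : 0 ≤ v := div_nonneg hz.1 hp0.le
  have hpv : mixed γ w c * v = M := by
    rw [hv]
    field_simp
  have hv1 : v ≤ 2 * k * M := by
    have h1 : 1 ≤ 2 * k * mixed γ w c := by
      have := mul_le_mul_of_nonneg_left hp (by positivity : (0 : ℝ) ≤ 2 * k)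
      rwa [mul_one_div_cancel (by positivity)] at this
    rw [← hpv]
    nlinarith
  have hηv : η * v ≤ 1 := by nlinarith [mul_le_mul_of_nonneg_left hv1 hη, hz.2, hz.1]
  have hexp : Real.exp (η * v) - 1 ≤ η * v + (η * v) ^ 2 := by
    have h0 : 0 ≤ η * v := mul_nonneg hη hv0
    have := (abs_le.1 (Real.abs_exp_sub_one_sub_id_le (abs_le.2 ⟨by linarith, hηv⟩))).2
    linarith
  have hqW : Real.exp (w c) = softmax w c * W := by
    unfold softmax
    rw [← hW]
    field_simp
  -- Passing from `softmax` to `2 * mixed` cancels the importance weight. In the quadratic term one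
  -- factor `v` becomes `M` this way and the other is at most `2 * k`, so the increment stays linear
  -- in `M` and can be summed by the mistake bound.
  have hb : softmax w c * (Real.exp (η * v) - 1) ≤ (2 * η + 4 * k * η ^ 2) * M := by
    have h0 : 0 ≤ η * v + (η * v) ^ 2 := by positivity
    have hq0 : 0 ≤ softmax w c := by
      unfold softmax
      positivity
    calc softmax w c * (Real.exp (η * v) - 1)
        ≤ softmax w c * (η * v + (η * v) ^ 2) := mul_le_mul_of_nonneg_left hexp hq0
      _ ≤ 2 * mixed γ w c * (η * v + (η * v) ^ 2) := mul_le_mul_of_nonneg_right hq h0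
      _ = 2 * η * (mixed γ w c * v) + 2 * η ^ 2 * (mixed γ w c * v) * v := by ring
      _ = 2 * η * M + 2 * η ^ 2 * M * v := by rw [hpv]
      _ ≤ 2 * η * M + 2 * η ^ 2 * M * (2 * k) := by
        have : v ≤ 2 * k := hv1.trans (by nlinarith [hz.2])
        have h2 := mul_le_mul_of_nonneg_left this
          (mul_nonneg (by positivity : 0 ≤ 2 * η ^ 2) hz.1)
        linarith
      _ = (2 * η + 4 * k * η ^ 2) * M := by ring
  have hle : W + Real.exp (w c) * (Real.exp (η * v) - 1) ≤
      W * Real.exp ((2 * η + 4 * k * η ^ 2) * M) := by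
    rw [hqW]
    have h1 := mul_le_mul_of_nonneg_left (hb.trans (sub_nonneg.1 (by
      have := Real.add_one_le_exp ((2 * η + 4 * k * η ^ 2) * M); linarith :
        (0 : ℝ) ≤ (Real.exp ((2 * η + 4 * k * η ^ 2) * M) - 1) -
          (2 * η + 4 * k * η ^ 2) * M))) hS.le
    linarith
  rw [hsplit]
  have hpos : 0 < W + Real.exp (w c) * (Real.exp (η * v) - 1) := by
    rw [← hsplit]
    exact Finset.sum_pos (fun y _ => Real.exp_pos _) Finset.univ_nonempty
  refine (Real.log_le_log hpos hle).trans_eq ?_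
  rw [Real.log_mul hS.ne' (Real.exp_pos _).ne', Real.log_exp]

theorem log_sum_exp_weight_le {γ : ℝ} (hγ : γ = 1 / 2) (hη : 0 ≤ η) (hη' : η * (2 * k) ≤ 1)
    (T : ℕ) (hL : ∀ t < T, ∀ (h : Fin t → Σ y, idx y) (z : Σ y, idx y),
      L z.1 z.2 (theta update θ₀ t h) ∈ Set.Icc (0 : ℝ) 1) (s : Fin T → Σ y, idx y) :
    Real.log (∑ y, Real.exp (weight L update θ₀ η γ T s y)) ≤
      Real.log k + (2 * η + 4 * k * η ^ 2) * ∑ t, roundLoss L update θ₀ s t := by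
  induction T with
  | zero => simp [weight]
  | succ T ih =>
    have h1 := ih (fun t ht => hL t (ht.trans T.lt_succ_self)) (Fin.init s)
    have h2 := log_sum_exp_step L η hγ hη hη' (weight L update θ₀ η γ T (Fin.init s))
      (s (Fin.last T)) (hL T T.lt_succ_self (Fin.init s) (s (Fin.last T)))
    have h3 : ∑ t, roundLoss L update θ₀ s t = (∑ t, roundLoss L update θ₀ (Fin.init s) t) +
        L (s (Fin.last T)).1 (s (Fin.last T)).2 (theta update θ₀ T (Fin.init s)) :=
      sum_rounds_succ (fun t h (z : Σ y, idx y) => L z.1 z.2 (theta update θ₀ t h)) T s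
    rw [h3, mul_add]
    simp only [weight]
    linarith

/-- The weight of one class is `η` times its total estimate and lies below the log-sum-exp. The
potential bound is `log k + 2 * η * C + 4 * k * η ^ 2 * C`, and each of the three terms is at most
`2 * η * C`. -/
theorem sum_pathEstimator_le {T : ℕ} {C : ℝ} {γ : ℝ}
    (hbdd : ∀ (s : Fin T → Σ y, idx y) (t : Fin T),
      roundLoss L update θ₀ s t ∈ Set.Icc (0 : ℝ) 1)
    (hmistake : MistakeBound L update θ₀ T C)
    (hη : η = √(Real.log k / (4 * k * C))) (hγ : γ = 1 / 2)
    (y : Fin k) (s : Fin T → Σ y, idx y) :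
    ∑ u : Fin T, pathEstimator L update θ₀ η γ y u (Fin.take u u.isLt.le s) (s u) ≤ 6 * C := by
  obtain ⟨C', hC', hle⟩ := hmistake
  have hC : k * Real.log k ≤ C := hC' ▸ le_max_left _ _
  have hsum := hle s
  have hsum0 : 0 ≤ ∑ t, roundLoss L update θ₀ s t := Finset.sum_nonneg fun t _ => (hbdd s t).1
  rcases Nat.lt_or_ge 1 k with hk1 | hk1
  · have hk : (1 : ℝ) < k := by exact_mod_cast hk1
    have hlog : 0 < Real.log k := Real.log_pos hk
    have hC0 : 0 < C := lt_of_lt_of_le (by positivity) hC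
    have hηpos : 0 < η := by
      rw [hη]
      positivity
    have hη2 : 4 * k * C * η ^ 2 = Real.log k := by
      rw [hη, Real.sq_sqrt (by positivity)]
      field_simp
    -- This is where `C ≥ k * log k` enters; it keeps the exponents in the range of the quadratic
    -- bound on `exp`.
    have hη' : η * (2 * k) ≤ 1 := by
      refine (pow_le_one_iff_of_nonneg (by positivity) two_ne_zero).1 ?_
      have h1 : C * (η * (2 * k)) ^ 2 = k * Real.log k := by
        rw [← hη2]
        ring
      have h2 : C * (η * (2 * k)) ^ 2 ≤ C * 1 := by linarith
      simpa using le_of_mul_le_mul_left h2 hC0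
    have h1 := log_sum_exp_weight_le L update θ₀ η hγ hηpos.le hη' T
      (fun t ht => loss_mem_Icc L update θ₀ hbdd ht) s
    have h2 : weight L update θ₀ η γ T s y ≤
        Real.log (∑ y, Real.exp (weight L update θ₀ η γ T s y)) := by
      rw [← Real.log_exp (weight L update θ₀ η γ T s y)]
      refine Real.log_le_log (Real.exp_pos _) ?_
      exact Finset.single_le_sum (f := fun y => Real.exp (weight L update θ₀ η γ T s y))
        (fun y _ => (Real.exp_pos _).le) (Finset.mem_univ y)
    rw [weight_eq_sum] at h2
    have h3 : (2 * η + 4 * k * η ^ 2) * ∑ t, roundLoss L update θ₀ s t ≤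
        (2 * η + 4 * k * η ^ 2) * C := mul_le_mul_of_nonneg_left hsum (by positivity)
    -- By the choice of `η`, `log k` factors as `(η * (2 * k)) * (η * (2 * C))`.
    have h4 : Real.log k ≤ η * (2 * C) := by
      have := mul_le_mul_of_nonneg_left hη' (by positivity : 0 ≤ η * (2 * C))
      linarith
    refine le_of_mul_le_mul_left ?_ hηpos
    linarith
  -- Here `η = 0`, so the potential gives nothing; but the only class has probability `1` and its
  -- estimates are the suffered losses.
  · obtain rfl : k = 1 := le_antisymm hk1 (NeZero.pos k)
    refine le_trans (le_of_eq (Finset.sum_congr rfl fun u _ => ?_)) (by linarith :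
      ∑ t, roundLoss L update θ₀ s t ≤ 6 * C)
    have hm (w : Fin 1 → ℝ) (y : Fin 1) : mixed γ w y = 1 := by
      have := sum_mixed γ w
      rwa [Fin.sum_univ_one, ← Subsingleton.elim y 0] at this
    simp only [pathEstimator, estimator, hm, div_one]
    rw [if_pos (Subsingleton.elim _ _)]
    rfl

end Regret

/-! ### Concentration of the estimators along the run and of the uniform draws. -/

section Concentration

variable [NeZero k] [∀ y, Fintype (idx y)] [∀ y, Nonempty (idx y)]

theorem expect_samplePMF (γ : Set.Ioo (0 : ℝ) 1) (w : Fin k → ℝ) (f : (Σ y, idx y) → ℝ) :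
    expect (samplePMF γ w) f =
      ∑ c, mixed γ w c * (1 / (Fintype.card (idx c) : ℝ) * ∑ i, f ⟨c, i⟩) := by
  unfold samplePMF
  simp only [expect_bind, expect_map, expect_uniform]
  unfold expect classPMF
  simp only [PMF.ofFintype_apply, ENNReal.toReal_ofReal (mixed_nonneg γ w _)]

/-- Gives both unbiasedness and the second moment. With `m ≠ 0` the samples from other classes
contribute `0 ^ m = 0`. -/
theorem expect_estimator_pow (γ : Set.Ioo (0 : ℝ) 1) (w : Fin k → ℝ)
    (θ : Θ) (y : Fin k) {m : ℕ} (hm : m ≠ 0) :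
    expect (samplePMF γ w) (fun z : Σ y, idx y => estimator L (mixed γ w) θ z y ^ m) =
      mixed γ w y * (1 / (Fintype.card (idx y) : ℝ) * ∑ i, (L y i θ / mixed γ w y) ^ m) := by
  rw [expect_samplePMF, Finset.sum_eq_single y]
  · simp [estimator]
  · intro c _ hc
    simp [estimator, hc.symm, hm]
  · simp

theorem expect_estimator {γ : Set.Ioo (0 : ℝ) 1} (hγ : (γ : ℝ) = 1 / 2) (w : Fin k → ℝ)
    (θ : Θ) (y : Fin k) :
    expect (samplePMF γ w) (fun z : Σ y, idx y => estimator L (mixed γ w) θ z y) =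
      empRisk L y θ := by
  have h := expect_estimator_pow L γ w θ y one_ne_zero
  simp only [pow_one] at h
  have hk : (0 : ℝ) < k := Nat.cast_pos.2 (NeZero.pos k)
  have hp0 : 0 < mixed γ w y := lt_of_lt_of_le (by positivity) (inv_le_mixed hγ w y)
  rw [h, ← Finset.sum_div]
  unfold empRisk
  field_simp

theorem expect_estimator_sq_le {γ : Set.Ioo (0 : ℝ) 1} (hγ : (γ : ℝ) = 1 / 2) (w : Fin k → ℝ)
    {θ : Θ} (h : ∀ z : Σ y, idx y, L z.1 z.2 θ ∈ Set.Icc (0 : ℝ) 1) (y : Fin k) :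
    expect (samplePMF γ w) (fun z : Σ y, idx y => estimator L (mixed γ w) θ z y ^ 2) ≤
      2 * k := by
  have hk : (0 : ℝ) < k := Nat.cast_pos.2 (NeZero.pos k)
  have hp := inv_le_mixed hγ w y
  have hp0 : 0 < mixed γ w y := lt_of_lt_of_le (by positivity) hp
  have hN : (0 : ℝ) < Fintype.card (idx y) := Nat.cast_pos.2 Fintype.card_pos
  rw [expect_estimator_pow L γ w θ y two_ne_zero]
  have h1 : ∑ i, (L y i θ / mixed γ w y) ^ 2 ≤ ∑ _i : idx y, (1 / mixed γ w y) ^ 2 := by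
    refine Finset.sum_le_sum fun i _ => ?_
    have hi := h ⟨y, i⟩
    exact pow_le_pow_left₀ (div_nonneg hi.1 hp0.le) (div_le_div_of_nonneg_right hi.2 hp0.le) 2
  rw [Finset.sum_const, Finset.card_univ, nsmul_eq_mul] at h1
  calc _ ≤ mixed γ w y * (1 / (Fintype.card (idx y) : ℝ) *
        (Fintype.card (idx y) * (1 / mixed γ w y) ^ 2)) := by gcongr
    _ = 1 / mixed γ w y := by field_simp
    _ ≤ 1 / (1 / (2 * k)) := one_div_le_one_div_of_le (by positivity) hp
    _ = 2 * k := by rw [one_div_one_div]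

/-- The exponential supermartingale argument: conditioning on the past, the last round contributes a
factor of at most `exp c`. -/
theorem expect_run_exp_le (γ : Set.Ioo (0 : ℝ) 1)
    (G : (t : ℕ) → (Fin t → Σ y, idx y) → (Σ y, idx y) → ℝ) (c : ℝ) (T : ℕ)
    (hG : ∀ t < T, ∀ h, expect (samplePMF γ (weight L update θ₀ η γ t h))
      (fun z => Real.exp (G t h z)) ≤ Real.exp c) :
    expect (run L update θ₀ η γ T)
      (fun s => Real.exp (∑ u : Fin T, G u (Fin.take u u.isLt.le s) (s u))) ≤
        Real.exp (T * c) := by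
  induction T with
  | zero => simp [run, expect_pure]
  | succ T ih =>
    simp only [run, expect_bind, expect_map, sum_rounds_succ G, Fin.init_snoc, Fin.snoc_last,
      Real.exp_add, expect_const_mul]
    have h1 := ih fun t ht => hG t (ht.trans T.lt_succ_self)
    refine (expect_mono _ fun s => mul_le_mul_of_nonneg_left (hG T T.lt_succ_self s)
      (Real.exp_pos _).le).trans ?_
    simp only [mul_comm _ (Real.exp c), expect_const_mul]
    refine (mul_le_mul_of_nonneg_left h1 (Real.exp_pos c).le).trans_eq ?_
    rw [← Real.exp_add]
    congr 1
    push_cast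
    ring

theorem expect_indicator_empRisk_sub_pathEstimator_le {γ : Set.Ioo (0 : ℝ) 1} {T : ℕ} [NeZero T]
    (hγ : (γ : ℝ) = 1 / 2)
    (hbdd : ∀ (s : Fin T → Σ y, idx y) (t : Fin T),
      roundLoss L update θ₀ s t ∈ Set.Icc (0 : ℝ) 1) (y : Fin k) {ε : ℝ} (hε : 0 ≤ ε) :
    expect (run L update θ₀ η γ T) ({s | √(2 * (2 * k * T) * ε) <
      ∑ u : Fin T, (empRisk L y (iterate update θ₀ s u) -
        pathEstimator L update θ₀ η γ y u (Fin.take u u.isLt.le s) (s u))}.indicator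
          fun _ => 1) ≤ Real.exp (-ε) := by
  have hk : (0 : ℝ) < k := Nat.cast_pos.2 (NeZero.pos k)
  have hT : (0 : ℝ) < T := Nat.cast_pos.2 (NeZero.pos T)
  refine expect_indicator_le_of_subgaussian _ _ (by positivity) hε fun r hr => ?_
  simp only [Finset.mul_sum]
  refine (expect_run_exp_le L update θ₀ η γ (fun t h z => r * (empRisk L y (theta update θ₀ t h) -
    pathEstimator L update θ₀ η γ y t h z)) (2 * k * r ^ 2 / 2) T fun t ht h => ?_).trans_eq ?_
  · have hL := loss_mem_Icc L update θ₀ hbdd ht h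
    exact expect_exp_sub_le _ (fun z => estimator_nonneg L (hL z).1 y)
      (expect_estimator L hγ _ _ y) (expect_estimator_sq_le L hγ _ hL y) hr
  · congr 1
    ring

end Concentration

end Runs

/-- An average of i.i.d. uniform draws from a finite family in `[0, 1]` exceeds the mean by
`√(2 n ε)` after summation with probability at most `exp (-ε)`. -/
theorem expect_indicator_iid_uniform_le {α : Type*} [Fintype α] [Nonempty α] {n : ℕ} [NeZero n]
    {f : α → ℝ} (hf : ∀ a, f a ∈ Set.Icc (0 : ℝ) 1) {ε : ℝ} (hε : 0 ≤ ε) :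
    expect (iid (PMF.uniformOfFintype α) n) ({τ | √(2 * n * ε) <
      ∑ j, (f (τ j) - 1 / (Fintype.card α : ℝ) * ∑ a, f a)}.indicator fun _ => 1) ≤
        Real.exp (-ε) := by
  have hn : (0 : ℝ) < n := Nat.cast_pos.2 (NeZero.pos n)
  refine expect_indicator_le_of_subgaussian _ _ hn hε fun r hr => ?_
  simp only [Finset.mul_sum]
  rw [expect_iid_exp_sum _ (fun a => r * (f a - ∑ a, 1 / (Fintype.card α : ℝ) * f a))]
  -- An upper tail for `f` is a lower tail for the nonnegative variable `1 - f`, whose second moment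
  -- is at most `1`.
  have hm : expect (PMF.uniformOfFintype α) (fun a => 1 + -1 * f a) =
      1 - ∑ a, 1 / (Fintype.card α : ℝ) * f a := by
    rw [expect_add, expect_const, expect_const_mul, expect_uniform, Finset.mul_sum]
    ring
  have hV : expect (PMF.uniformOfFintype α) (fun a => (1 + -1 * f a) ^ 2) ≤ 1 := by
    refine (expect_mono _ fun a => ?_).trans_eq (expect_const _ 1)
    nlinarith [(hf a).1, (hf a).2]
  have h := expect_exp_sub_le _ (fun a => by linarith [(hf a).2]) hm hV hr
  refine (pow_le_pow_left₀ (Finset.sum_nonneg fun a _ => by positivity)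
    (le_trans (le_of_eq ?_) h) n).trans_eq ?_
  · congr 1
    ext a
    congr 1
    ring
  · rw [← Real.exp_nat_mul]
    congr 1
    ring

/-! ### Deviation events and the ensemble bound. -/

section Ensemble

variable {k : ℕ} [NeZero k] {Θ : Type*} {idx : Fin k → Type*} [∀ y, Fintype (idx y)]
  (L : (y : Fin k) → idx y → Θ → ℝ)
  (update : Θ → (Σ y, idx y) → Θ) (θ₀ : Θ) (η : ℝ)

/-- The runs along which the realized class-conditioned risks of class `y` exceed their estimates
by more than the deviation `√(4 k T ε)` in total. -/
def estimatorDeviation (γ : ℝ) (T n : ℕ) (ε : ℝ) (y : Fin k) :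
    Set ((Fin T → Σ y, idx y) × (Fin n → Fin T)) :=
  {ω | √(2 * (2 * k * T) * ε) < ∑ u : Fin T, (empRisk L y (iterate update θ₀ ω.1 u) -
    pathEstimator L update θ₀ η γ y u (Fin.take u u.isLt.le ω.1) (ω.1 u))}

/-- The draws for which the ensemble risk of class `y` exceeds the average risk over the rounds
by more than the deviation `√(2 n ε)` in total. -/
def samplingDeviation (T n : ℕ) (ε : ℝ) (y : Fin k) :
    Set ((Fin T → Σ y, idx y) × (Fin n → Fin T)) :=
  {ω | √(2 * n * ε) < ∑ j, (empRisk L y (iterate update θ₀ ω.1 (ω.2 j)) -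
    1 / (Fintype.card (Fin T) : ℝ) * ∑ u, empRisk L y (iterate update θ₀ ω.1 u))}

variable {L update θ₀ η}

/-- Away from the deviation events, the ensemble satisfies the risk bound. -/
theorem worstRisk_le_of_notMem {γ : ℝ} {T n : ℕ} [NeZero T] [NeZero n] {C ε : ℝ}
    (hε : 0 ≤ ε) (hγ : γ = 1 / 2)
    (hbdd : ∀ (s : Fin T → Σ y, idx y) (t : Fin T),
      roundLoss L update θ₀ s t ∈ Set.Icc (0 : ℝ) 1)
    (hmistake : MistakeBound L update θ₀ T C) (hη : η = √(Real.log k / (4 * k * C)))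
    {ω : (Fin T → Σ y, idx y) × (Fin n → Fin T)}
    (h1 : ∀ y, ω ∉ estimatorDeviation L update θ₀ η γ T n ε y)
    (h2 : ∀ y, ω ∉ samplingDeviation L update θ₀ T n ε y) :
    worstRisk L (fun j => iterate update θ₀ ω.1 (ω.2 j)) ≤
      6 * C / T + √(4 * k * ε) / √T + √(2 * ε) / √n := by
  have hT : (0 : ℝ) < T := Nat.cast_pos.2 (NeZero.pos T)
  have hn : (0 : ℝ) < n := Nat.cast_pos.2 (NeZero.pos n)
  refine ciSup_le fun y => ?_
  have ha := h1 y
  have hb := h2 y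
  simp only [estimatorDeviation, samplingDeviation, Set.mem_ofPred_eq, not_lt] at ha hb
  have hr := sum_pathEstimator_le L update θ₀ η hbdd hmistake hη hγ y ω.1
  rw [Finset.sum_sub_distrib] at ha hb
  rw [Finset.sum_const, Finset.card_univ, nsmul_eq_mul, Fintype.card_fin, Fintype.card_fin] at hb
  set R := ∑ u, empRisk L y (iterate update θ₀ ω.1 u)
  have hsT : √(2 * (2 * k * T) * ε) = √(4 * k * ε) * √T := by
    rw [← Real.sqrt_mul (by positivity)]
    congr 1
    ring
  have hsn : √(2 * n * ε) = √(2 * ε) * √n := by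
    rw [← Real.sqrt_mul (by positivity)]
    congr 1
    ring
  rw [hsT] at ha
  rw [hsn] at hb
  have hdiv (a : ℝ) {m : ℝ} (hm : 0 < m) : a / √m = a * √m / m := by
    rw [div_eq_div_iff (Real.sqrt_pos.2 hm).ne' hm.ne', mul_assoc, Real.mul_self_sqrt hm.le]
  rw [hdiv _ hT, hdiv _ hn, ← add_div]
  have hR : 1 / T * R ≤ (6 * C + √(4 * k * ε) * √T) / T := by
    rw [one_div_mul_eq_div]
    exact div_le_div_of_nonneg_right (by linarith) hT.le
  calc _ ≤ 1 / (n : ℝ) * (n * (1 / T * R) + √(2 * ε) * √n) :=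
        mul_le_mul_of_nonneg_left (by linarith) (by positivity)
    _ = 1 / T * R + √(2 * ε) * √n / n := by field_simp
    _ ≤ _ := by linarith

variable [∀ y, Nonempty (idx y)]

theorem expect_runEnsemble (γ : Set.Ioo (0 : ℝ) 1) (T n : ℕ) [NeZero T]
    (f : (Fin T → Σ y, idx y) × (Fin n → Fin T) → ℝ) :
    expect (runEnsemble L update θ₀ η γ T n) f =
      expect (run L update θ₀ η γ T) fun s =>
        expect (iid (PMF.uniformOfFintype (Fin T)) n) fun τ => f (s, τ) := by
  unfold runEnsemble
  simp only [expect_bind, expect_map]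

theorem expect_estimatorDeviation_le {γ : Set.Ioo (0 : ℝ) 1} {T n : ℕ} [NeZero T]
    (hγ : (γ : ℝ) = 1 / 2)
    (hbdd : ∀ (s : Fin T → Σ y, idx y) (t : Fin T),
      roundLoss L update θ₀ s t ∈ Set.Icc (0 : ℝ) 1) (y : Fin k) {ε : ℝ} (hε : 0 ≤ ε) :
    expect (runEnsemble L update θ₀ η γ T n)
      ((estimatorDeviation L update θ₀ η γ T n ε y).indicator fun _ => 1) ≤ Real.exp (-ε) := by
  rw [expect_runEnsemble]
  refine le_trans (le_of_eq ?_)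
    (expect_indicator_empRisk_sub_pathEstimator_le L update θ₀ η hγ hbdd y hε)
  congr 1
  ext s
  -- The event depends on the run alone, so the draw can be fixed arbitrarily.
  exact expect_const (iid (PMF.uniformOfFintype (Fin T)) n)
    ((estimatorDeviation L update θ₀ η γ T n ε y).indicator (fun _ => 1) (s, fun _ => 0))

theorem expect_samplingDeviation_le {γ : Set.Ioo (0 : ℝ) 1} {T n : ℕ} [NeZero T] [NeZero n]
    (hbdd : ∀ (s : Fin T → Σ y, idx y) (t : Fin T),
      roundLoss L update θ₀ s t ∈ Set.Icc (0 : ℝ) 1) (y : Fin k) {ε : ℝ} (hε : 0 ≤ ε) :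
    expect (runEnsemble L update θ₀ η γ T n)
      ((samplingDeviation L update θ₀ T n ε y).indicator fun _ => 1) ≤ Real.exp (-ε) := by
  rw [expect_runEnsemble]
  refine (expect_mono _ fun s => ?_).trans_eq (expect_const _ (Real.exp (-ε)))
  exact expect_indicator_iid_uniform_le (f := fun u => empRisk L y (iterate update θ₀ s u))
    (fun u => empRisk_mem_Icc L (loss_mem_Icc L update θ₀ hbdd u.isLt _) y) hε

end Ensemble

end CFOL

theorem theorem1 {k : ℕ} [NeZero k] {Θ E : Type*} [AddCommGroup E]
    {idx : Fin k → Type*} [∀ y, Fintype (idx y)] [∀ y, Nonempty (idx y)]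
    (l : Θ → E → Fin k → ℝ) (S : Set E) (x : (y : Fin k) → idx y → E)
    (L : (y : Fin k) → idx y → Θ → ℝ) (hL : L = CFOL.advLoss l S x)
    (update : Θ → (Σ y, idx y) → Θ) (θ₀ : Θ)
    (T n : ℕ) [NeZero T] [NeZero n] (C η δ : ℝ) (γ : Set.Ioo (0 : ℝ) 1)
    (hbdd : ∀ (s : Fin T → Σ y, idx y) (t : Fin T),
      CFOL.roundLoss L update θ₀ s t ∈ Set.Icc (0 : ℝ) 1)
    (hmistake : CFOL.MistakeBound L update θ₀ T C)
    (hη : η = √(Real.log k / (4 * k * C))) (hγ : (γ : ℝ) = 1 / 2)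
    (hδ : δ ∈ Set.Ioo (0 : ℝ) 1) :
    ENNReal.ofReal (1 - δ) ≤
      (CFOL.runEnsemble L update θ₀ η γ T n).toOuterMeasure
        {ω | CFOL.worstRisk L (fun j => CFOL.iterate update θ₀ ω.1 (ω.2 j)) ≤
          6 * C / T + √(4 * k * Real.log (2 * k / δ)) / √T
            + (1 + 2 * k) * Real.log (2 * k / δ) / (3 * T)
            + √(2 * Real.log (2 * k / δ)) / √n
            + 2 * Real.log (2 * k / δ) / (3 * n)} := by
  have hk : (1 : ℝ) ≤ k := by exact_mod_cast NeZero.one_le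
  have hδ0 := hδ.1
  have hε : 0 ≤ Real.log (2 * k / δ) := by
    refine Real.log_nonneg ?_
    rw [le_div_iff₀ hδ0]
    linarith [hδ.2]
  have hexp : Real.exp (-Real.log (2 * k / δ)) = δ / (2 * k) := by
    rw [Real.exp_neg, Real.exp_log (by positivity), inv_div]
  set ε := Real.log (2 * k / δ)
  rw [CFOL.toOuterMeasure_eq_expect]
  refine ENNReal.ofReal_le_ofReal (le_trans (le_of_eq ?_) (CFOL.le_expect_indicator
    (ι := Fin k ⊕ Fin k) _ _ (Sum.elim (CFOL.estimatorDeviation L update θ₀ η γ T n ε)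
      (CFOL.samplingDeviation L update θ₀ T n ε)) (e := δ / (2 * k)) ?_ ?_))
  · rw [Fintype.card_sum, Fintype.card_fin]
    push_cast
    field_simp
    ring
  · rw [← hexp]
    rintro (y | y)
    · exact CFOL.expect_estimatorDeviation_le hγ hbdd y hε
    · exact CFOL.expect_samplingDeviation_le hbdd y hε
  · intro ω hω
    have h := CFOL.worstRisk_le_of_notMem hε hγ hbdd hmistake hη
      (fun y => hω (Sum.inl y)) (fun y => hω (Sum.inr y))
    -- The remaining two terms of the stated bound only need to be nonnegative.
    have h1 : 0 ≤ (1 + 2 * k) * ε / (3 * T) := by positivity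
    have h2 : 0 ≤ 2 * ε / (3 * n) := by positivity
    refine h.trans ?_
    linarith
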